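/- Let $Z$ be a real Banach space that has an extended $\lambda$-approximative basis ($\lambda$-EAB) with $1\le\lambda<2$, that is, a net $(P_\alpha)_{\alpha\in\mathscr D}$ of bounded finite rank operators on $Z$, indexed by a (nonempty) directed set, such that $\sup_\alpha\|P_\alpha\|\le\lambda$ and $\lim_\alpha P_\alpha z=z$ in norm for every $z\in Z$. Let $C\subset Z$ be nonempty, weakly compact and convex. Call a map $T\colon C\to C$ $\mathfrak{cm}$-nonexpansive if it is nonexpansive ($\|Tx-Ty\|\le\|x-y\|$ for all $x,y\in C$) and \[ \limsup_{i\to\infty}\ \sup_{A\subset\{1,\dots,n\}}\Big\|\sum_{k\in A}\big(Tu_{i+k}-Ty\big)\Big\|\ \le\ \limsup_{i\to\infty}\ \sup_{A\subset\{1,\dots,n\}}\Big\|\sum_{k\in A}\big(u_{i+k}-y\big)\Big\| \] for all $n\in\mathbb N$, all $y\in C$ and all sequences $(u_i)$ in $C$. Suppose that $C$ fails the fixed point property for $\mathfrak{cm}$-nonexpansive maps, i.e. some $\mathfrak{cm}$-nonexpansive map $T\colon C\to C$ has no fixed point. Then $C$ fails the weak Banach–Saks property: it is not true that for every sequence $(x_n)$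 in $C$ converging weakly to some $x\in Z$ there is a subsequence $(y_i)$ of $(x_n)$ whose averages $\frac1n\sum_{i=1}^n y_i$ converge to $x$ in norm. -/

import Mathlib

open Filter Topology
open scoped ENNReal

/-- `(P α)`, indexed by a directed set `D`, is an extended `lam`-approximative basis
(`lam`-EAB) of `Z`: a net of finite rank bounded operators, of norm at most `lam` with
`1 ≤ lam`, that converges pointwise in norm to the identity. -/
structure IsEAB {Z : Type*} [NormedAddCommGroup Z] [NormedSpace ℝ Z]
    {D : Type*} [Preorder D] (lam : ℝ) (P : D → Z →L[ℝ] Z) : Prop where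
  nonempty : Nonempty D
  directed : ∀ a b : D, ∃ c : D, a ≤ c ∧ b ≤ c
  one_le : 1 ≤ lam
  finite_rank : ∀ a : D, FiniteDimensional ℝ (LinearMap.range (P a : Z →ₗ[ℝ] Z))
  norm_le : ∀ a : D, ‖P a‖ ≤ lam
  tendsto : ∀ z : Z, Tendsto (fun a : D => P a z) atTop (𝓝 z)

/-- Compactness in the weak topology of `Z`. -/
def IsWeaklyCompact {Z : Type*} [NormedAddCommGroup Z] [NormedSpace ℝ Z] (C : Set Z) : Prop :=
  IsCompact (toWeakSpace ℝ Z '' C)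

/-- Convergence of a sequence in the weak topology of `Z`. -/
def WeaklyTendsto {Z : Type*} [NormedAddCommGroup Z] [NormedSpace ℝ Z]
    (x : ℕ → Z) (z : Z) : Prop :=
  Tendsto (fun n => toWeakSpace ℝ Z (x n)) atTop (𝓝 (toWeakSpace ℝ Z z))

/-- `limsup_{i → ∞} sup_{A ⊆ {1, …, n}} ‖∑_{k ∈ A} (v_{i+k} - y)‖`, computed in `[0, ∞]`
(where suprema and upper limits always exist). -/
noncomputable def cesaroSize {Z : Type*} [NormedAddCommGroup Z]
    (n : ℕ) (v : ℕ → Z) (y : Z) : ℝ≥0∞ :=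
  limsup (fun i : ℕ => ⨆ A ∈ (Finset.Icc 1 n).powerset, ‖∑ k ∈ A, (v (i + k) - y)‖ₑ) atTop

/-- A self-map of `C` is Cesàro mean nonexpansive if it is nonexpansive and does not
increase `cesaroSize`. -/
structure IsCMNonexpansive {Z : Type*} [NormedAddCommGroup Z] {C : Set Z} (T : C → C) :
    Prop where
  nonexpansive : ∀ x y : C, ‖(T x : Z) - T y‖ ≤ ‖(x : Z) - y‖
  cesaro_le : ∀ (n : ℕ) (y : C) (u : ℕ → C),
    cesaroSize n (fun i => (T (u i) : Z)) (T y) ≤ cesaroSize n (fun i => (u i : Z)) y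

/-- Every Cesàro mean nonexpansive self-map of `C` has a fixed point. -/
def HasCMFixedPointProperty {Z : Type*} [NormedAddCommGroup Z] (C : Set Z) : Prop :=
  ∀ T : C → C, IsCMNonexpansive T → ∃ x : C, T x = x

/-- The weak Banach–Saks property of a set `C`: whenever a sequence in `C` converges weakly
to some `z`, the averages of some subsequence converge to `z` in norm. -/
def HasWeakBanachSaks {Z : Type*} [NormedAddCommGroup Z] [NormedSpace ℝ Z] (C : Set Z) : Prop :=
  ∀ (x : ℕ → Z) (z : Z), (∀ n, x n ∈ C) → WeaklyTendsto x z →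
    ∃ φ : ℕ → ℕ, StrictMono φ ∧
      Tendsto (fun n : ℕ => (n : ℝ)⁻¹ • ∑ i ∈ Finset.range n, x (φ i)) atTop (𝓝 z)

/-! The contrapositive is proved. A nonexpansive `T` on `C` has points `x k` with `T (x k) - x k →
0`, and by weak sequential compactness these may be taken weakly convergent to some `y` in `C`. The
weak Banach–Saks property gives small averages only along some subsequence. Ramsey's theorem makes
this uniform (`exists_subseq_norm_sum_le`): after thinning, every subset of a far-out window of a
suitable length `n` has sum of the `x k - y` at most `δ * n`, so the Cesàro size about `y` is at
most `δ * n`.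

Cesàro mean nonexpansiveness carries the bound over to the `T (x k)` about `T y`. Since `T (x k) - T
y` converges weakly to `y - T y`, the sum over a full window tends weakly to `n • (y - T y)`, and
weak lower semicontinuity of the norm bounds `‖y - T y‖` by a multiple of `δ`
(`norm_sub_le_of_cesaroSize_le`). As `δ` is arbitrary, `T y = y`. -/

/-! ### Ramsey theory -/

/-- Fusion: repeatedly remove the minimum `n` and shrink the rest to satisfy `R n`; the removed
minima form `H`. -/
theorem Set.Infinite.exists_diagonal {R : ℕ → Set ℕ → Prop}
    (hmono : ∀ n S S', S' ⊆ S → R n S → R n S')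
    (hex : ∀ n (S : Set ℕ), S.Infinite → ∃ S' ⊆ S, S'.Infinite ∧ R n S')
    {S : Set ℕ} (hS : S.Infinite) :
    ∃ H ⊆ S, H.Infinite ∧ ∀ n ∈ H, R n (H ∩ Set.Ioi n) := by
  have step : ∀ S : {S : Set ℕ // S.Infinite}, ∃ S' : {S : Set ℕ // S.Infinite},
      S'.1 ⊆ S.1 ∧ S'.1 ⊆ Set.Ioi (sInf S.1) ∧ R (sInf S.1) S'.1 := by
    rintro ⟨S, hS⟩
    have h1 : (S ∩ Set.Ioi (sInf S)).Infinite := by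
      have : S \ Set.Iic (sInf S) = S ∩ Set.Ioi (sInf S) := by ext; simp
      rw [← this]
      exact hS.sdiff (Set.finite_Iic _)
    obtain ⟨S', hS', hi, hR⟩ := hex (sInf S) _ h1
    exact ⟨⟨S', hi⟩, hS'.trans Set.inter_subset_left, hS'.trans Set.inter_subset_right, hR⟩
  choose next hnext hgt hR using step
  let s : ℕ → {S : Set ℕ // S.Infinite} := fun k => next^[k] ⟨S, hS⟩
  have hs : ∀ k, s (k + 1) = next (s k) := fun k => Function.iterate_succ_apply' _ _ _
  let a : ℕ → ℕ := fun k => sInf (s k).1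
  have ha : ∀ k, a k ∈ (s k).1 := fun k => Nat.sInf_mem (s k).2.nonempty
  have hanti : Antitone fun k => (s k).1 := antitone_nat_of_succ_le fun k => by
    rw [hs]; exact hnext _
  have hmono_a : StrictMono a := strictMono_nat_of_lt_succ fun k => by
    have h := ha (k + 1)
    rw [hs] at h
    exact hgt _ h
  refine ⟨Set.range a, ?_, Set.infinite_range_of_injective hmono_a.injective, ?_⟩
  · rintro _ ⟨k, rfl⟩
    exact hanti (Nat.zero_le k) (ha k)
  · rintro _ ⟨k, rfl⟩
    refine hmono _ _ _ ?_ (hR (s k))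
    rintro _ ⟨⟨j, rfl⟩, hj⟩
    rw [← hs]
    exact hanti (Nat.succ_le_of_lt (hmono_a.lt_iff_lt.1 hj)) (ha j)

/-- Ramsey's theorem for two-colourings of the `m`-element subsets of an infinite set. -/
theorem Set.Infinite.exists_homogeneous (m : ℕ) (c : Finset ℕ → Prop) {S : Set ℕ}
    (hS : S.Infinite) :
    ∃ H ⊆ S, H.Infinite ∧ ∃ p : Prop, ∀ B : Finset ℕ, (B : Set ℕ) ⊆ H → B.card = m →
      (c B ↔ p) := by
  induction m generalizing c S with
  | zero =>
    refine ⟨S, subset_rfl, hS, c ∅, fun B _ hB => ?_⟩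
    rw [Finset.card_eq_zero.1 hB]
  | succ m ih =>
    obtain ⟨H, hHS, hH, hR⟩ := Set.Infinite.exists_diagonal
      (R := fun n S' => ∃ p : Prop, ∀ B : Finset ℕ, (B : Set ℕ) ⊆ S' → B.card = m →
        (c (insert n B) ↔ p))
      (fun n S S' h ⟨p, hp⟩ => ⟨p, fun B hB => hp B (hB.trans h)⟩)
      (fun n S hS => ih (fun B => c (insert n B)) hS) hS
    choose! p hp using hR
    -- On `H` the colour of an `(m + 1)`-set depends only on its minimum, so it remains to
    -- pigeonhole over the colours of the minima.
    have key : ∀ (q : Prop) (H' : Set ℕ), H' ⊆ H → (∀ n ∈ H', (p n ↔ q)) →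
        ∀ B : Finset ℕ, (B : Set ℕ) ⊆ H' → B.card = m + 1 → (c B ↔ q) := by
      intro q H' hH' hq B hB hcard
      have hne : B.Nonempty := Finset.card_pos.1 (by omega)
      have hmin := B.min'_mem hne
      have h := hp _ (hH' (hB hmin)) (B.erase (B.min' hne)) (fun b hb => by
        have hb' := Finset.mem_coe.1 hb
        exact ⟨hH' (hB (Finset.mem_of_mem_erase hb')), B.min'_lt_of_mem_erase_min' hne hb'⟩)
        (by rw [Finset.card_erase_of_mem hmin, hcard]; rfl)
      rw [Finset.insert_erase hmin] at h
      exact h.trans (hq _ (hB hmin))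
    have hsplit : {n ∈ H | p n} ∪ {n ∈ H | ¬ p n} = H := by
      ext n; by_cases h : p n <;> simp [h]
    rw [← hsplit, Set.infinite_union] at hH
    rcases hH with h | h
    · exact ⟨_, (Set.sep_subset _ _).trans hHS, h, True,
        key _ _ (Set.sep_subset _ _) fun n hn => iff_true_intro hn.2⟩
    · exact ⟨_, (Set.sep_subset _ _).trans hHS, h, False,
        key _ _ (Set.sep_subset _ _) fun n hn => iff_false_intro hn.2⟩

/-- One sequence serves all sizes `m` at once because `m`-sets are only tested beyond index `m`; `m
≤ a m` ensures that size `m` has been treated by then. -/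
theorem exists_strictMono_homogeneous (c : ℕ → Finset ℕ → Prop) :
    ∃ a : ℕ → ℕ, StrictMono a ∧ ∀ m, ∃ p : Prop, ∀ B : Finset ℕ, (∀ b ∈ B, m < b) →
      B.card = m → (c m (B.image a) ↔ p) := by
  obtain ⟨H, -, hH, hR⟩ := Set.Infinite.exists_diagonal (S := Set.univ)
    (R := fun n S => ∀ m < n + 1, ∃ p : Prop, ∀ B : Finset ℕ, (B : Set ℕ) ⊆ S → B.card = m →
      (c m B ↔ p))
    (fun n S S' h hS m hm => by
      obtain ⟨p, hp⟩ := hS m hm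
      exact ⟨p, fun B hB => hp B (hB.trans h)⟩)
    (fun n S hS => by
      induction n + 1 with
      | zero => exact ⟨S, subset_rfl, hS, fun m hm => absurd hm (Nat.not_lt_zero m)⟩
      | succ k ih =>
        obtain ⟨S₁, hS₁, hi₁, h₁⟩ := ih
        obtain ⟨S₂, hS₂, hi₂, h₂⟩ := hi₁.exists_homogeneous k (c k)
        refine ⟨S₂, hS₂.trans hS₁, hi₂, fun m hm => ?_⟩
        rcases Nat.lt_succ_iff_lt_or_eq.1 hm with hm | rfl
        · obtain ⟨p, hp⟩ := h₁ m hm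
          exact ⟨p, fun B hB => hp B (hB.trans hS₂)⟩
        · exact h₂)
    Set.infinite_univ
  have ha : StrictMono (Nat.nth (· ∈ H)) := Nat.nth_strictMono hH
  have hmem : ∀ k, Nat.nth (· ∈ H) k ∈ H := fun k => Nat.nth_mem_of_infinite hH k
  refine ⟨Nat.nth (· ∈ H), ha, fun m => ?_⟩
  obtain ⟨p, hp⟩ := hR _ (hmem m) m (Nat.lt_succ_of_le (ha.le_apply))
  refine ⟨p, fun B hB hcard => hp _ ?_ ?_⟩
  · intro x hx
    obtain ⟨b, hb, rfl⟩ := Finset.mem_image.1 (Finset.mem_coe.1 hx)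
    exact ⟨hmem b, ha (hB b hb)⟩
  · rw [Finset.card_image_of_injective _ ha.injective, hcard]

theorem cesaroSize_le_of_forall_norm_le {Z : Type*} [NormedAddCommGroup Z] {n : ℕ} {v : ℕ → Z} {y : Z}
    {r : ℝ}
    (h : ∀ i ≥ n, ∀ A ⊆ Finset.Icc 1 n, ‖∑ k ∈ A, (v (i + k) - y)‖ ≤ r) :
    cesaroSize n v y ≤ ENNReal.ofReal r := by
  refine limsup_le_of_le (h := ?_)
  filter_upwards [eventually_ge_atTop n] with i hi
  refine iSup₂_le fun A hA => ?_
  rw [← ofReal_norm]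
  exact ENNReal.ofReal_le_ofReal (h i hi A (Finset.mem_powerset.1 hA))

/-! ### Weak compactness and weak sequential compactness -/

section NormedSpace

variable {Z : Type*} [NormedAddCommGroup Z] [NormedSpace ℝ Z]

theorem WeaklyTendsto.comp_strictMono {x : ℕ → Z} {z : Z} (h : WeaklyTendsto x z) {φ : ℕ → ℕ}
    (hφ : StrictMono φ) : WeaklyTendsto (x ∘ φ) z :=
  Tendsto.comp (f := φ) (g := fun n => toWeakSpace ℝ Z (x n)) h hφ.tendsto_atTop

theorem continuous_strongDual_weakSpace (f : StrongDual ℝ Z) :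
    Continuous fun w : WeakSpace ℝ Z => f ((toWeakSpace ℝ Z).symm w) :=
  WeakBilin.eval_continuous (topDualPairing ℝ Z).flip f

theorem WeaklyTendsto.tendsto_apply {x : ℕ → Z} {z : Z} (h : WeaklyTendsto x z)
    (f : StrongDual ℝ Z) : Tendsto (fun n => f (x n)) atTop (𝓝 (f z)) :=
  ((continuous_strongDual_weakSpace f).tendsto _).comp h

theorem IsWeaklyCompact.exists_norm_le {C : Set Z} (hC : IsWeaklyCompact C) :
    ∃ M, ∀ x ∈ C, ‖x‖ ≤ M := by
  have h : ∀ f : StrongDual ℝ Z, ∃ M, ∀ x : C,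
      ‖NormedSpace.inclusionInDoubleDual ℝ Z (x : Z) f‖ ≤ M := by
    intro f
    obtain ⟨M, hM⟩ := hC.exists_bound_of_continuousOn
      (continuous_strongDual_weakSpace f).continuousOn
    exact ⟨M, fun x => by simpa using hM _ ⟨x, x.2, rfl⟩⟩
  obtain ⟨M, hM⟩ := banach_steinhaus h
  refine ⟨M, fun x hx => ?_⟩
  have := hM ⟨x, hx⟩
  exact ((NormedSpace.inclusionInDoubleDualLi ℝ (E := Z)).norm_map x).symm.trans_le this

theorem IsWeaklyCompact.isClosed {C : Set Z} (hC : IsWeaklyCompact C) : IsClosed C := by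
  have h : IsClosed (toWeakSpaceCLM ℝ Z ⁻¹' (toWeakSpace ℝ Z '' C)) :=
    (IsCompact.isClosed hC).preimage (toWeakSpaceCLM ℝ Z).continuous
  have h' : toWeakSpaceCLM ℝ Z ⁻¹' (toWeakSpace ℝ Z '' C) = C := by
    ext x
    rw [Set.mem_preimage, toWeakSpaceCLM_eq_toWeakSpace, ← Set.mem_preimage,
      Set.preimage_image_eq _ (toWeakSpace ℝ Z).injective]
  rwa [h'] at h

/-- Functionals norming the points of a countable dense set suffice: if all vanish at `z`, then `‖d
n‖ ≤ ‖z - d n‖` for `d n` arbitrarily close to `z`. -/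
theorem exists_seq_strongDual_separating {S : Set Z} (hS : TopologicalSpace.IsSeparable S) :
    ∃ f : ℕ → StrongDual ℝ Z, ∀ z ∈ S, (∀ n, f n z = 0) → z = 0 := by
  obtain ⟨c, hc, hSc⟩ := hS
  rcases S.eq_empty_or_nonempty with rfl | hne
  · exact ⟨0, by simp⟩
  have hcne : c.Nonempty := closure_nonempty_iff.1 (hne.mono hSc)
  obtain ⟨d, rfl⟩ := hc.exists_eq_range hcne
  choose f hf hfd using fun n => exists_dual_vector'' ℝ (d n)
  refine ⟨f, fun z hz h0 => ?_⟩
  rw [← norm_le_zero_iff]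
  refine le_of_forall_pos_le_add fun ε hε => ?_
  obtain ⟨_, ⟨n, rfl⟩, hn⟩ := Metric.mem_closure_iff.1 (hSc hz) (ε / 2) (half_pos hε)
  rw [dist_eq_norm] at hn
  have h1 : ‖d n‖ ≤ ‖z - d n‖ := by
    have h2 : ‖f n (d n - z)‖ ≤ 1 * ‖d n - z‖ := (f n).le_of_opNorm_le (hf n) _
    rw [map_sub, h0 n, hfd n, norm_sub_rev (d n) z] at h2
    simpa using h2
  have h3 : ‖z‖ ≤ ‖z - d n‖ + ‖d n‖ := by simpa using norm_add_le (z - d n) (d n)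
  linarith

/-- Weakly compact sets are weakly sequentially compact. -/
theorem IsWeaklyCompact.exists_subseq_weaklyTendsto {C : Set Z} (hC : IsWeaklyCompact C)
    {x : ℕ → Z} (hx : ∀ n, x n ∈ C) :
    ∃ y ∈ C, ∃ φ : ℕ → ℕ, StrictMono φ ∧ WeaklyTendsto (x ∘ φ) y := by
  let V : Submodule ℝ Z := (Submodule.span ℝ (Set.range x)).topologicalClosure
  have hVsep : TopologicalSpace.IsSeparable (V : Set Z) := by
    rw [Submodule.topologicalClosure_coe]
    exact (Set.countable_range x).isSeparable.span.closure
  have hxV : ∀ n, x n ∈ V := fun n =>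
    Submodule.le_topologicalClosure _ (Submodule.subset_span ⟨n, rfl⟩)
  have hVclosed : IsClosed (toWeakSpace ℝ Z '' (V : Set Z)) := by
    have h := (V.convex).toWeakSpace_closure ℝ
    rw [(Submodule.isClosed_topologicalClosure _).closure_eq] at h
    rw [h]
    exact isClosed_closure
  obtain ⟨f, hf⟩ := exists_seq_strongDual_separating hVsep
  let g : WeakSpace ℝ Z → ℕ → ℝ := fun w n => f n ((toWeakSpace ℝ Z).symm w)
  have hg : Continuous g := continuous_pi fun n => continuous_strongDual_weakSpace (f n)
  obtain ⟨b, -, φ, hφ, hb⟩ := (IsCompact.image hC hg).tendsto_subseq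
    (x := fun n => g (toWeakSpace ℝ Z (x n))) fun n => ⟨_, ⟨x n, hx n, rfl⟩, rfl⟩
  have hK : IsCompact (toWeakSpace ℝ Z '' C ∩ toWeakSpace ℝ Z '' (V : Set Z)) :=
    IsCompact.inter_right hC hVclosed
  let u : ℕ → WeakSpace ℝ Z := fun n => toWeakSpace ℝ Z (x (φ n))
  have huK : ∀ n, u n ∈ toWeakSpace ℝ Z '' C ∩ toWeakSpace ℝ Z '' (V : Set Z) := fun n =>
    ⟨⟨_, hx _, rfl⟩, ⟨_, hxV _, rfl⟩⟩
  -- All weak cluster points of the subsequence share the coordinates `b`. They lie in `V`, where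
  -- the `f n` separate points, so there is only one, and compactness gives convergence.
  have hclus : ∀ w, MapClusterPt w atTop u → g w = b := by
    intro w hw
    have h1 : MapClusterPt (g w) atTop (g ∘ u) := hw.continuousAt_comp hg.continuousAt
    exact eq_of_nhds_neBot (h1.neBot.mono (inf_le_inf_left _ hb))
  obtain ⟨w, hwK, hw⟩ := hK.exists_mapClusterPt_of_frequently (l := atTop) (f := u)
    (Eventually.of_forall huK).frequently
  obtain ⟨⟨y, hyC, rfl⟩, hyV⟩ := hwK
  refine ⟨y, hyC, φ, hφ, ?_⟩
  refine hK.tendsto_nhds_of_unique_mapClusterPt (Eventually.of_forall huK) fun w' hw'K hw' => ?_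
  obtain ⟨y', hy'V, rfl⟩ := hw'K.2
  obtain ⟨y'', hyV, hyy⟩ := hyV
  obtain rfl := (toWeakSpace ℝ Z).injective hyy
  congr 1
  refine sub_eq_zero.1 (hf _ (V.sub_mem hy'V hyV) fun n => ?_)
  have h := congrFun ((hclus _ hw').trans (hclus _ hw).symm) n
  rw [map_sub, sub_eq_zero]
  simpa [g] using h

/-! ### Approximate fixed points, window sums and the fixed point -/

/-- The map `(1 - t) • T + t • x₀` is a contraction of `C`; at its fixed point, `T x - x = t • (T x
- x₀)`. -/
theorem exists_norm_sub_le_of_nonexpansive [CompleteSpace Z] {C : Set Z} (hne : C.Nonempty)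
    (hclosed : IsClosed C) (hconv : Convex ℝ C) {M : ℝ} (hM : ∀ x ∈ C, ‖x‖ ≤ M) {T : C → C}
    (hT : ∀ x y : C, ‖(T x : Z) - T y‖ ≤ ‖(x : Z) - y‖) {ε : ℝ} (hε : 0 < ε) :
    ∃ x : C, ‖(T x : Z) - x‖ ≤ ε := by
  obtain ⟨x₀, hx₀⟩ := hne
  have hM0 : 0 ≤ M := (norm_nonneg _).trans (hM _ hx₀)
  obtain ⟨t, ht0, ht1, htM⟩ : ∃ t : ℝ, 0 < t ∧ t < 1 ∧ t * (2 * M) ≤ ε := by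
    refine ⟨min (1 / 2) (ε / (2 * M + 1)), by positivity, ?_, ?_⟩
    · exact (min_le_left _ _).trans_lt (by norm_num)
    · calc _ ≤ ε / (2 * M + 1) * (2 * M + 1) :=
            mul_le_mul (min_le_right _ _) (by linarith) (by positivity) (by positivity)
        _ = ε := by field_simp
  let F : C → C := fun x => ⟨(1 - t) • (T x : Z) + t • x₀,
    hconv (T x).2 hx₀ (by linarith) ht0.le (by ring)⟩
  have : CompleteSpace C := hclosed.completeSpace_coe
  have : Nonempty C := ⟨⟨x₀, hx₀⟩⟩
  have hF : ContractingWith (1 - t).toNNReal F := by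
    refine ⟨?_, LipschitzWith.of_dist_le_mul fun x y => ?_⟩
    · rw [← NNReal.coe_lt_coe, Real.coe_toNNReal _ (by linarith)]
      simpa using ht0
    · rw [Real.coe_toNNReal _ (by linarith), Subtype.dist_eq, Subtype.dist_eq, dist_eq_norm,
        dist_eq_norm]
      have h : (F x : Z) - F y = (1 - t) • ((T x : Z) - T y) := by
        simp only [F, smul_sub]; abel
      rw [h, norm_smul, Real.norm_of_nonneg (by linarith)]
      exact mul_le_mul_of_nonneg_left (hT x y) (by linarith)
  obtain ⟨x, hx⟩ : ∃ x, F x = x := ⟨_, hF.fixedPoint_isFixedPt⟩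
  refine ⟨x, ?_⟩
  have hx' : (1 - t) • (T x : Z) + t • x₀ = x := congrArg Subtype.val hx
  have h : (T x : Z) - x = t • ((T x : Z) - x₀) := by
    have h' : (T x : Z) - x = (T x : Z) - ((1 - t) • (T x : Z) + t • x₀) := by rw [hx']
    rw [h']
    module
  rw [h, norm_smul, Real.norm_of_nonneg ht0.le]
  refine le_trans (mul_le_mul_of_nonneg_left ?_ ht0.le) htM
  linarith [norm_sub_le (T x : Z) x₀, hM _ (T x).2, hM _ hx₀]

/-- If every subsequence of a bounded sequence `g` has a further subsequence with norm null
Cesàro means, then a subsequence of `g` has uniformly small partial sums over windows of a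
suitable length `n`. -/
theorem exists_subseq_norm_sum_le {g : ℕ → Z} {M : ℝ} (hM : ∀ k, ‖g k‖ ≤ M)
    (hg : ∀ a : ℕ → ℕ, StrictMono a → ∃ φ : ℕ → ℕ, StrictMono φ ∧
      Tendsto (fun n : ℕ => (n : ℝ)⁻¹ • ∑ i ∈ Finset.range n, g (a (φ i))) atTop (𝓝 0))
    {δ : ℝ} (hδ : 0 < δ) :
    ∃ n : ℕ, 0 < n ∧ ∃ a : ℕ → ℕ, StrictMono a ∧ ∀ i ≥ n, ∀ A ⊆ Finset.Icc 1 n,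
      ‖∑ k ∈ A, g (a (i + k))‖ ≤ δ * n := by
  obtain ⟨a, ha, hp⟩ := exists_strictMono_homogeneous fun m B => ‖∑ b ∈ B, g b‖ ≤ δ * m
  choose p hp using hp
  obtain ⟨φ, hφ, hlim⟩ := hg a ha
  -- The factor `1 / 5` pays for subtracting initial sums of lengths `2 * m + 1` and `m + 1` below:
  -- `3 * m + 2 ≤ 5 * m`.
  have hev : ∀ᶠ n : ℕ in atTop, ‖∑ i ∈ Finset.range n, g (a (φ i))‖ ≤ δ / 5 * n := by
    filter_upwards [hlim.norm.eventually_lt_const (by rw [norm_zero]; positivity : ‖(0 : Z)‖ < δ / 5),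
      eventually_gt_atTop 0] with n hn hn0
    have hn0' : (0 : ℝ) < n := Nat.cast_pos.2 hn0
    rw [norm_smul, norm_inv, Real.norm_natCast, inv_mul_lt_iff₀ hn0'] at hn
    linarith
  obtain ⟨N, hN⟩ := eventually_atTop.1 hev
  -- One good `m`-set decides the colour: terms `m + 1` to `2 * m` of the Banach–Saks subsequence
  -- have indices beyond `m`.
  have hgood : ∀ m, N + 1 ≤ m → p m := by
    intro m hm
    rw [← hp m ((Finset.Ico (m + 1) (2 * m + 1)).image φ)]
    · rw [Finset.sum_image fun _ _ _ _ h => ha.injective h,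
        Finset.sum_image fun _ _ _ _ h => hφ.injective h, Finset.sum_Ico_eq_sub _ (by omega)]
      refine (norm_sub_le _ _).trans ((add_le_add (hN _ (by omega)) (hN _ (by omega))).trans ?_)
      have : (1 : ℝ) ≤ m := by exact_mod_cast (by omega : 1 ≤ m)
      push_cast
      nlinarith
    · intro b hb
      obtain ⟨j, hj, rfl⟩ := Finset.mem_image.1 hb
      have := hφ.le_apply (x := j)
      have := (Finset.mem_Ico.1 hj).1
      omega
    · rw [Finset.card_image_of_injective _ hφ.injective, Nat.card_Ico]
      omega
  have hM0 : 0 ≤ M := (norm_nonneg _).trans (hM 0)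
  -- Sets too small for `hgood` are handled trivially: their sums are at most `(N + 1) * M ≤ δ *
  -- n₀`.
  obtain ⟨n₀, hn₀⟩ := exists_nat_ge ((N + 1) * M / δ)
  refine ⟨n₀ + 1, n₀.succ_pos, a, ha, fun i hi A hA => ?_⟩
  have hcard : A.card ≤ n₀ + 1 := by simpa using Finset.card_le_card hA
  rcases le_or_gt (N + 1) A.card with h | h
  · have hinj : Function.Injective fun k => i + k := add_right_injective i
    have h1 := (hp A.card (A.image fun k => i + k) (fun b hb => by
      obtain ⟨j, hj, rfl⟩ := Finset.mem_image.1 hb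
      have := (Finset.mem_Icc.1 (hA hj)).1
      omega) (Finset.card_image_of_injective _ hinj)).2 (hgood _ h)
    rw [Finset.sum_image fun _ _ _ _ h => ha.injective h,
      Finset.sum_image fun _ _ _ _ h => hinj h] at h1
    refine h1.trans (mul_le_mul_of_nonneg_left ?_ hδ.le)
    exact_mod_cast hcard
  · have h1 : ‖∑ k ∈ A, g (a (i + k))‖ ≤ A.card * M := by
      simpa using norm_sum_le_of_le A fun k _ => hM (a (i + k))
    have h2 : (A.card : ℝ) ≤ N + 1 := by exact_mod_cast h.le
    rw [div_le_iff₀ hδ] at hn₀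
    push_cast
    nlinarith [mul_le_mul_of_nonneg_right h2 hM0]

theorem norm_sub_le_of_cesaroSize_le {n : ℕ} (hn : 0 < n) {u v : ℕ → Z} {y z : Z} {δ : ℝ}
    (hδ : 0 < δ) (huv : Tendsto (fun k => v k - u k) atTop (𝓝 0)) (hu : WeaklyTendsto u y)
    (hv : cesaroSize n v z ≤ ENNReal.ofReal (δ * n)) : ‖y - z‖ ≤ 3 * δ := by
  have hn' : (0 : ℝ) < n := Nat.cast_pos.2 hn
  -- Relaxing `δ` to `2 * δ` makes the inequality strict, so that it holds eventually under the
  -- limsup; replacing `v` by `u` costs the third `δ`.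
  have hlt : cesaroSize n v z < ENNReal.ofReal (2 * δ * n) :=
    hv.trans_lt ((ENNReal.ofReal_lt_ofReal_iff (by positivity)).2 (by nlinarith))
  have h1 : ∀ᶠ i : ℕ in atTop, ‖∑ k ∈ Finset.Icc 1 n, (v (i + k) - z)‖ ≤ 2 * δ * n := by
    filter_upwards [eventually_lt_of_limsup_lt hlt] with i hi
    have h := (le_iSup₂ (f := fun A (_ : A ∈ (Finset.Icc 1 n).powerset) =>
      ‖∑ k ∈ A, (v (i + k) - z)‖ₑ) (Finset.Icc 1 n) (Finset.mem_powerset_self _)).trans_lt hi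
    rw [← ofReal_norm, ENNReal.ofReal_lt_ofReal_iff (by positivity)] at h
    exact h.le
  have h2 : ∀ᶠ i : ℕ in atTop, ∀ k, ‖v (i + k) - u (i + k)‖ ≤ δ := by
    obtain ⟨N, hN⟩ := eventually_atTop.1 (huv.norm.eventually_lt_const (by simpa using hδ))
    exact eventually_atTop.2 ⟨N, fun i hi k => (hN _ (by omega)).le⟩
  obtain ⟨f, hf, hfy⟩ := exists_dual_vector'' ℝ (y - z)
  have hlim : Tendsto (fun i : ℕ => ∑ k ∈ Finset.Icc 1 n, f (u (i + k) - z)) atTop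
      (𝓝 (n * ‖y - z‖)) := by
    have h := tendsto_finsetSum (Finset.Icc 1 n) fun k _ =>
      (((hu.tendsto_apply f).comp (tendsto_add_atTop_nat k)).sub_const (f z))
    simpa [← map_sub, hfy] using h
  have h3 : n * ‖y - z‖ ≤ 3 * δ * n := by
    refine le_of_tendsto hlim ?_
    filter_upwards [h1, h2] with i hi1 hi2
    have hsum : ∑ k ∈ Finset.Icc 1 n, (u (i + k) - z) =
        ∑ k ∈ Finset.Icc 1 n, (v (i + k) - z) -
          ∑ k ∈ Finset.Icc 1 n, (v (i + k) - u (i + k)) := by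
      rw [← Finset.sum_sub_distrib]
      exact Finset.sum_congr rfl fun k _ => by abel
    have h4 : ‖∑ k ∈ Finset.Icc 1 n, (v (i + k) - u (i + k))‖ ≤ n * δ := by
      simpa using norm_sum_le_of_le (Finset.Icc 1 n) fun k _ => hi2 k
    have h5 := norm_sub_le (∑ k ∈ Finset.Icc 1 n, (v (i + k) - z))
      (∑ k ∈ Finset.Icc 1 n, (v (i + k) - u (i + k)))
    rw [← map_sum, hsum]
    refine (le_abs_self _).trans (((f.le_of_opNorm_le hf _).trans_eq (one_mul _)).trans ?_)
    linarith
  nlinarith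

/-- A weakly compact convex set with the weak Banach–Saks property has the fixed point property
for Cesàro mean nonexpansive maps. -/
theorem HasWeakBanachSaks.hasCMFixedPointProperty [CompleteSpace Z] {C : Set Z}
    (hWBS : HasWeakBanachSaks C) (hne : C.Nonempty) (hcompact : IsWeaklyCompact C)
    (hconv : Convex ℝ C) : HasCMFixedPointProperty C := by
  intro T hT
  obtain ⟨M, hM⟩ := hcompact.exists_norm_le
  choose w hw using fun k : ℕ => exists_norm_sub_le_of_nonexpansive hne hcompact.isClosed hconv hM
    hT.nonexpansive (Nat.one_div_pos_of_nat (α := ℝ) (n := k))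
  have hafp : Tendsto (fun k => (T (w k) : Z) - w k) atTop (𝓝 0) :=
    squeeze_zero_norm hw tendsto_one_div_add_atTop_nhds_zero_nat
  obtain ⟨y, hy, φ, hφ, hwy⟩ := hcompact.exists_subseq_weaklyTendsto fun k => (w k).2
  let x : ℕ → C := w ∘ φ
  have hxy : WeaklyTendsto (fun k => (x k : Z)) y := hwy
  refine ⟨⟨y, hy⟩, Subtype.ext (sub_eq_zero.1 (norm_le_zero_iff.1 ?_))⟩
  rw [norm_sub_rev]
  refine le_of_forall_pos_le_add fun ε hε => ?_
  obtain ⟨n, hn, a, ha, hsum⟩ := exists_subseq_norm_sum_le (g := fun k => (x k : Z) - y)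
    (M := M + M) (fun k => (norm_sub_le _ _).trans (add_le_add (hM _ (x k).2) (hM _ hy)))
    (fun a ha => by
      obtain ⟨ψ, hψ, hlim⟩ := hWBS (fun k => x (a k)) y (fun k => (x (a k)).2)
        (hxy.comp_strictMono ha)
      refine ⟨ψ, hψ, ?_⟩
      rw [← sub_self y]
      refine (hlim.sub_const y).congr' ?_
      filter_upwards [eventually_gt_atTop 0] with m hm
      have hm' : (m : ℝ) ≠ 0 := Nat.cast_ne_zero.2 hm.ne'
      rw [Finset.sum_sub_distrib, smul_sub, Finset.sum_const, Finset.card_range,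
        ← Nat.cast_smul_eq_nsmul ℝ, inv_smul_smul₀ hm'])
    (by positivity : 0 < ε / 3)
  have h := norm_sub_le_of_cesaroSize_le hn (by positivity : 0 < ε / 3)
    (hafp.comp (hφ.comp ha).tendsto_atTop) (hxy.comp_strictMono ha)
    ((hT.cesaro_le n ⟨y, hy⟩ fun k => x (a k)).trans
      (cesaroSize_le_of_forall_norm_le (v := fun k => (x (a k) : Z)) hsum))
  rw [zero_add]
  linarith

end NormedSpace

theorem mainTheorem2 {Z : Type*} [NormedAddCommGroup Z] [NormedSpace ℝ Z] [CompleteSpace Z]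
    {D : Type*} [Preorder D] (lam : ℝ) (hlam : lam < 2) (P : D → Z →L[ℝ] Z)
    (hP : IsEAB lam P)
    (C : Set Z) (hC_nonempty : C.Nonempty) (hC_compact : IsWeaklyCompact C)
    (hC_convex : Convex ℝ C) (hC_fails : ¬ HasCMFixedPointProperty C) :
    ¬ HasWeakBanachSaks C :=
  fun hWBS => hC_fails (hWBS.hasCMFixedPointProperty hC_nonempty hC_compact hC_convex)
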